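/- **Setting.** Fix a horizon $T\ge 1$. At each time $t=1,\dots,T$ the buyer has a value $v_t\in[0,1]$, the seller posts a price $p_t\in[0,1]$ and observes only the signal $\sigma_t=\mathbf 1\{p_t\le v_t\}$. The average revenue loss is $\frac1T\sum_{t=1}^T (v_t-p_t\sigma_t)$. A (randomized) online pricing algorithm chooses $p_t$ from its internal randomness and $\sigma_1,\dots,\sigma_{t-1}$. An adaptive adversary chooses $v_t$ as a (measurable) function of $p_1,\dots,p_{t-1}$. It has changing rates $\epsilon_1,\dots,\epsilon_T$ if $|v_{t+1}-v_t|\le\epsilon_t$ for all $1\le t<T$, whatever prices are posted. Write $\bar\epsilon=\frac1T\sum_{t=1}^T\epsilon_t$. **Theorem.** 1. There are constants $C>0$, $k\in\mathbb N$, a function $g:\mathbb N\to\mathbb R$ with $g(T)\to0$ as $T\to\infty$, and for each $T$ a randomized online pricing algorithm $A_T$ (which depends on $T$ only, and so does not know the changing rates or their average) such that for every $T\ge1$, every non-increasing sequence $1\ge\epsilon_1\ge\dots\ge\epsilon_T\ge0$ and every adaptive adversary with changing rates $\epsilon_1,\dots,\epsilon_T$, the expected average revenue loss of $A_T$ is at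 most $$C\,\bar\epsilon^{1/2}\,\bigl(1+\log(1/\bar\epsilon)\bigr)^k+g(T)$$ (where the first term is read as $0$ if $\bar\epsilon=0$). That is, the loss is $\tilde O(\bar\epsilon^{1/2})$, where $\tilde O(f)$ means $O(f)\,\mathrm{polylog}(1/\bar\epsilon)+o(1)$ with $o(1)$ with respect to $T$. 2. This is tight: there is a constant $c>0$ such that for every $T\ge1$, every $\epsilon\in[0,1]$ and every randomized online pricing algorithm (even one that depends on $T$ and $\epsilon$), there is a fixed value sequence $v_1,\dots,v_T\in[0,1]$ with constant changing rates $\epsilon_t=\epsilon$ (so $\bar\epsilon=\epsilon$) on which the expected average revenue loss of the algorithm is at least $c\,\bar\epsilon^{1/2}$. -/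

import Mathlib

open MeasureTheory Filter Topology

noncomputable section

/-- A randomized online pricing algorithm. A random seed `ω` is drawn from a probability space;
the price posted at time `t` (times are `0, 1, 2, …`) depends on the seed and on the binary
sale signals `σ 0, …, σ (t - 1)` observed so far, which are the only feedback.
Past prices are functions of the seed and of the earlier signals, so they are available too. -/
structure PricingAlgorithm where
  Seed : Type
  [measurableSpace : MeasurableSpace Seed]
  law : Measure Seed
  [isProbabilityMeasure : IsProbabilityMeasure law]
  price : (t : ℕ) → Seed → (Fin t → Bool) → unitInterval
  measurable_price : ∀ (t : ℕ) (σ : Fin t → Bool), Measurable fun ω => price t ω σ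

attribute [instance] PricingAlgorithm.measurableSpace PricingAlgorithm.isProbabilityMeasure

/-- An adaptive adversary (the buyer): the value at time `t` depends on the prices posted
at times `0, …, t - 1`, but neither on the price of time `t` nor on the seller's seed.
(The past signals are determined by the past prices and the adversary's own past values.) -/
structure Adversary where
  value : (t : ℕ) → (Fin t → unitInterval) → unitInterval
  measurable_value : ∀ t : ℕ, Measurable (value t)

namespace Adversary

/-- The oblivious adversary that plays a value sequence fixed in advance. -/
def oblivious (v : ℕ → unitInterval) : Adversary where
  value t _ := v t
  measurable_value _ := measurable_const

/-- Whatever prices are posted, consecutive values among the first `T` ones satisfy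
`|v (t + 1) - v t| ≤ ε t`. -/
def HasChangingRate (B : Adversary) {T : ℕ} (ε : Fin T → ℝ) : Prop :=
  ∀ (t : ℕ) (ht : t + 1 < T) (p : Fin (t + 1) → unitInterval),
    |(B.value (t + 1) p : ℝ) - (B.value t (Fin.init p) : ℝ)| ≤ ε ⟨t, Nat.lt_of_succ_lt ht⟩

end Adversary

/-- The average changing rate `(1 / T) ∑ ε t`. -/
def averageRate {T : ℕ} (ε : Fin T → ℝ) : ℝ := (∑ t, ε t) / T

namespace PricingAlgorithm

variable (A : PricingAlgorithm) (B : Adversary)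

/-- The prices and sale signals of times `0, …, t - 1` when the algorithm with seed `ω` faces
the adversary. The item is sold exactly if the price is at most the value. -/
def history (ω : A.Seed) : (t : ℕ) → Fin t → unitInterval × Bool
  | 0 => Fin.elim0
  | t + 1 =>
    let h := history ω t
    let p := A.price t ω fun s => (h s).2
    let v := B.value t fun s => (h s).1
    Fin.snoc h (p, decide (p ≤ v))

/-- The price posted at time `t`. -/
def postedPrice (ω : A.Seed) (t : ℕ) : unitInterval :=
  A.price t ω fun s => (A.history B ω t s).2

/-- The buyer's value at time `t`. -/
def buyerValue (ω : A.Seed) (t : ℕ) : unitInterval :=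
  B.value t fun s => (A.history B ω t s).1

open Classical in
/-- The average revenue loss over the times `0, …, T - 1`. -/
def revenueLoss (T : ℕ) (ω : A.Seed) : ℝ :=
  (∑ t ∈ Finset.range T,
    ((A.buyerValue B ω t : ℝ) -
      if A.postedPrice B ω t ≤ A.buyerValue B ω t then (A.postedPrice B ω t : ℝ) else 0)) / T

/-- The expectation of the average revenue loss over the seller's randomness. -/
def expectedRevenueLoss (T : ℕ) : ℝ := ∫ ω, A.revenueLoss B T ω ∂A.law

theorem measurable_price_joint (t : ℕ) :
    Measurable fun x : A.Seed × (Fin t → Bool) => A.price t x.1 x.2 :=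
  measurable_from_prod_countable_left (fun σ => A.measurable_price t σ)

theorem measurable_history (t : ℕ) : Measurable fun ω => A.history B ω t := by
  induction t with
  | zero => exact measurable_of_subsingleton_codomain _
  | succ t ih =>
    have h1 : Measurable fun ω => A.price t ω fun s => (A.history B ω t s).2 :=
      (A.measurable_price_joint t).comp (f := fun ω => (ω, fun s => (A.history B ω t s).2))
        (measurable_id.prodMk (measurable_pi_lambda _ fun s =>
          measurable_snd.comp ((measurable_pi_apply s).comp ih)))
    have h2 : Measurable fun ω => B.value t fun s => (A.history B ω t s).1 :=
      (B.measurable_value t).comp (measurable_pi_lambda _ fun s =>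
          measurable_fst.comp ((measurable_pi_apply s).comp ih))
    refine measurable_pi_lambda _ fun s => ?_
    refine Fin.lastCases ?_ (fun s => ?_) s
    · simp only [history, Fin.snoc_last]
      refine h1.prodMk ?_
      refine measurable_to_bool ?_
      have : (fun ω => decide ((A.price t ω fun s => (A.history B ω t s).2) ≤ B.value t fun s => (A.history B ω t s).1)) ⁻¹' {true} = {ω | (A.price t ω fun s => (A.history B ω t s).2) ≤ B.value t fun s => (A.history B ω t s).1} := by ext; simp
      rw [this]
      exact measurableSet_le h1 h2
    · simp only [history, Fin.snoc_castSucc]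
      exact (measurable_pi_apply s).comp ih

/-- The integral defining the expected revenue loss is always meaningful. -/
theorem integrable_revenueLoss (T : ℕ) : Integrable (A.revenueLoss B T) A.law := by
  have h1 (t) : Measurable fun ω => A.postedPrice B ω t :=
      (A.measurable_price_joint t).comp (f := fun ω => (ω, fun s => (A.history B ω t s).2))
        (measurable_id.prodMk (measurable_pi_lambda _ fun s =>
          measurable_snd.comp ((measurable_pi_apply s).comp (A.measurable_history B t))))
  have h2 (t) : Measurable fun ω => A.buyerValue B ω t :=
      (B.measurable_value t).comp (measurable_pi_lambda _ fun s =>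
          measurable_fst.comp ((measurable_pi_apply s).comp (A.measurable_history B t)))
  refine Integrable.div_const (integrable_finsetSum _ fun t _ => ?_) _
  have hm : Measurable fun ω => ((A.buyerValue B ω t : ℝ) -
      if A.postedPrice B ω t ≤ A.buyerValue B ω t then (A.postedPrice B ω t : ℝ) else 0) :=
    (measurable_subtype_coe.comp (h2 t)).sub
      (Measurable.ite (measurableSet_le (h1 t) (h2 t)) (measurable_subtype_coe.comp (h1 t)) measurable_const)
  refine Integrable.of_bound hm.aestronglyMeasurable 1 (.of_forall fun ω => ?_)
  have a := (A.buyerValue B ω t).2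
  have b := (A.postedPrice B ω t).2
  rw [Real.norm_eq_abs, abs_le]
  split_ifs <;> constructor <;> linarith [a.1, a.2, b.1, b.2]
end PricingAlgorithm

end

/-! Lower bound. Start from the constant value `1/2` and allow, in each block of `2h` rounds with `h
≈ 1/(2√e)`, a tent of slope `e`, whose area `e h²` is of order one. A price above `1/2` loses `1/2`
in a flat block; without such a price both blocks produce the same signals, and the tent block loses
the whole area. So one of the two loses at least `1/8` in expectation (`exists_oblivious_blocks`),
and a constant loss every `2h` rounds is an average loss of order `√e`.

Upper bound. A tracker of level `i` supposes that the rate is at most `4^(-i)` and keeps an interval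
of width `W` for the value. With probability `δ = 2^(-i)/4` each it checks the upper end or bisects;
otherwise it posts the lower end. The potential `2^i (16 + 8W)` makes the expected loss plus
potential change at most `17 · 2^(-i)` per round (`Tracker.expected_cost_le`): a bisection frees `4W
· 2^i`, on average the loss `W` of exploiting; a refuted level frees at least `4 · 2^i`, on average
the loss `1` suffered while the value is outside. Only false hypotheses are refuted, so `2^(-i)`
stays below `2√r + 2^(-K)`, where `K` is the starting level and `r` bounds the rates
(`Tracker.Invariant.half_pow_level_le`).

Levels only fall, whereas the rates decrease; hence the restart at level `K` every `M` rounds. By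
monotonicity, using the rate at the start of each epoch costs only `M` extra in the sum of square
roots (`sum_sqrt_epoch_start_le`). Cauchy–Schwarz gives `√(averageRate ε)`, with no logarithm. -/

noncomputable section

/-! ### Round losses and histories -/

namespace PricingAlgorithm

variable (A : PricingAlgorithm) (B : Adversary)

open Classical in
/-- The revenue loss of a single round. -/
def roundLoss (ω : A.Seed) (t : ℕ) : ℝ :=
  (A.buyerValue B ω t : ℝ) -
    if A.postedPrice B ω t ≤ A.buyerValue B ω t then (A.postedPrice B ω t : ℝ) else 0

/-- The revenue loss accumulated over the first `n` rounds. -/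
def cumulativeLoss (n : ℕ) (ω : A.Seed) : ℝ := ∑ t ∈ Finset.range n, A.roundLoss B ω t

theorem revenueLoss_eq_cumulativeLoss_div (T : ℕ) (ω : A.Seed) :
    A.revenueLoss B T ω = A.cumulativeLoss B T ω / T := rfl

theorem expectedRevenueLoss_eq_integral_cumulativeLoss_div (T : ℕ) :
    A.expectedRevenueLoss B T = (∫ ω, A.cumulativeLoss B T ω ∂A.law) / T := by
  simp only [expectedRevenueLoss, revenueLoss_eq_cumulativeLoss_div, integral_div]

theorem integrable_cumulativeLoss (n : ℕ) : Integrable (A.cumulativeLoss B n) A.law := by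
  rcases Nat.eq_zero_or_pos n with rfl | hn
  · exact integrable_zero _ _ _
  · have h := (A.integrable_revenueLoss B n).mul_const (n : ℝ)
    have hn' : (n : ℝ) ≠ 0 := by positivity
    refine h.congr (.of_forall fun ω => ?_)
    exact div_mul_cancel₀ _ hn'

theorem roundLoss_nonneg (ω : A.Seed) (t : ℕ) : 0 ≤ A.roundLoss B ω t := by
  unfold roundLoss
  split_ifs with h
  · have : (A.postedPrice B ω t : ℝ) ≤ A.buyerValue B ω t := h
    linarith
  · linarith [(A.buyerValue B ω t).2.1]

theorem history_congr {A : PricingAlgorithm} {B B' : Adversary} {ω ω' : A.Seed} {t : ℕ}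
    (hA : ∀ s < t, A.price s ω = A.price s ω') (hB : ∀ s < t, B.value s = B'.value s) :
    A.history B ω t = A.history B' ω' t := by
  induction t with
  | zero => rfl
  | succ t ih =>
    have h := ih (fun s hs => hA s (by omega)) (fun s hs => hB s (by omega))
    simp only [history, h, hA t (by omega), hB t (by omega)]

theorem history_succ (ω : A.Seed) (t : ℕ) :
    A.history B ω (t + 1) = Fin.snoc (α := fun _ => unitInterval × Bool) (A.history B ω t)
      (A.postedPrice B ω t, decide (A.postedPrice B ω t ≤ A.buyerValue B ω t)) := rfl

theorem init_signals_succ (ω : A.Seed) (t : ℕ) :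
    (Fin.init (α := fun _ => Bool) fun s => (A.history B ω (t + 1) s).2) =
      fun s => (A.history B ω t s).2 := by
  funext s
  simp [Fin.init, history_succ]

theorem last_signals_succ (ω : A.Seed) (t : ℕ) :
    (A.history B ω (t + 1) (Fin.last t)).2 =
      decide (A.postedPrice B ω t ≤ A.buyerValue B ω t) := by
  simp [history_succ]

theorem init_prices_succ (ω : A.Seed) (t : ℕ) :
    (Fin.init (α := fun _ => unitInterval) fun s => (A.history B ω (t + 1) s).1) =
      fun s => (A.history B ω t s).1 := by
  funext s
  simp [Fin.init, history_succ]

variable {A B}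

theorem buyerValue_congr {ω ω' : A.Seed} {t : ℕ} (h : A.history B ω t = A.history B ω' t) :
    A.buyerValue B ω t = A.buyerValue B ω' t := by
  rw [buyerValue, h, buyerValue]

theorem _root_.Adversary.HasChangingRate.abs_buyerValue_succ_sub_le {T : ℕ} {ε : Fin T → ℝ}
    (hB : B.HasChangingRate ε) (ω : A.Seed) {t : ℕ} (ht : t + 1 < T) :
    |(A.buyerValue B ω (t + 1) : ℝ) - A.buyerValue B ω t| ≤ ε ⟨t, Nat.lt_of_succ_lt ht⟩ := by
  have h := hB t ht fun s => (A.history B ω (t + 1) s).1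
  rwa [init_prices_succ] at h

theorem roundLoss_of_le {ω : A.Seed} {t : ℕ} (h : A.postedPrice B ω t ≤ A.buyerValue B ω t) :
    A.roundLoss B ω t = A.buyerValue B ω t - A.postedPrice B ω t := by
  rw [roundLoss, if_pos h]

theorem roundLoss_of_lt {ω : A.Seed} {t : ℕ} (h : A.buyerValue B ω t < A.postedPrice B ω t) :
    A.roundLoss B ω t = A.buyerValue B ω t := by
  rw [roundLoss, if_neg (not_le.2 h), sub_zero]

end PricingAlgorithm

/-! ### Lower bound: indistinguishable value sequences -/

namespace PricingAlgorithm

theorem buyerValue_oblivious (A : PricingAlgorithm) (v : ℕ → unitInterval) (ω : A.Seed) (t : ℕ) :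
    A.buyerValue (Adversary.oblivious v) ω t = v t := rfl

theorem roundLoss_oblivious_congr (A : PricingAlgorithm) {v w : ℕ → unitInterval} {t : ℕ}
    (h : ∀ s ≤ t, v s = w s) (ω : A.Seed) :
    A.roundLoss (.oblivious v) ω t = A.roundLoss (.oblivious w) ω t := by
  have hh : A.history (.oblivious v) ω t = A.history (.oblivious w) ω t :=
    history_congr (fun _ _ => rfl) fun s hs => by
      funext _
      exact h s hs.le
  have hp : A.postedPrice (.oblivious v) ω t = A.postedPrice (.oblivious w) ω t := by
    rw [postedPrice, hh, ← postedPrice]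
  rw [roundLoss, roundLoss, hp, buyerValue_oblivious, buyerValue_oblivious, h t le_rfl]

theorem cumulativeLoss_oblivious_congr (A : PricingAlgorithm) {v w : ℕ → unitInterval} {n : ℕ}
    (h : ∀ s < n, v s = w s) (ω : A.Seed) :
    A.cumulativeLoss (.oblivious v) n ω = A.cumulativeLoss (.oblivious w) n ω :=
  Finset.sum_congr rfl fun _ ht => A.roundLoss_oblivious_congr
    (fun s hs => h s (hs.trans_lt (Finset.mem_range.1 ht))) ω

/-- Two value sequences that agree before time `s`, after which the first is constantly `b` and
the second at least `b`, cannot be told apart without a price above `b`, which the first one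
rejects. -/
theorem min_le_cumulativeLoss_sub_add (A : PricingAlgorithm) {v w : ℕ → unitInterval}
    {s n : ℕ} {b : unitInterval} (hlt : ∀ t < s, v t = w t)
    (hv : ∀ t, s ≤ t → t < s + n → v t = b) (hw : ∀ t, s ≤ t → t < s + n → b ≤ w t) (ω : A.Seed) :
    min (b : ℝ) (∑ j ∈ Finset.range n, ((w (s + j) : ℝ) - b)) ≤
      (A.cumulativeLoss (.oblivious v) (s + n) ω - A.cumulativeLoss (.oblivious v) s ω) +
      (A.cumulativeLoss (.oblivious w) (s + n) ω - A.cumulativeLoss (.oblivious w) s ω) := by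
  simp only [cumulativeLoss, Finset.sum_range_add, add_sub_cancel_left]
  have nonneg (x : ℕ → unitInterval) :
      0 ≤ ∑ j ∈ Finset.range n, A.roundLoss (.oblivious x) ω (s + j) :=
    Finset.sum_nonneg fun j _ => A.roundLoss_nonneg _ ω _
  by_cases hp : ∃ j < n, b < A.postedPrice (.oblivious v) ω (s + j)
  · obtain ⟨j, hj, hbj⟩ := hp
    have h1 : A.roundLoss (.oblivious v) ω (s + j) = b := by
      have hvj := hv (s + j) (by omega) (by omega)
      rw [roundLoss_of_lt (by rwa [buyerValue_oblivious, hvj]), buyerValue_oblivious, hvj]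
    have h2 := Finset.single_le_sum (f := fun j => A.roundLoss (.oblivious v) ω (s + j))
      (fun j _ => A.roundLoss_nonneg _ ω _) (Finset.mem_range.2 hj)
    exact (min_le_left _ _).trans (by linarith [nonneg w])
  · push Not at hp
    -- If no price exceeds `b`, every round from `s` on is a sale under both sequences, so the
    -- histories coincide and `w` loses at least `w - b` in each of these rounds.
    have hh : ∀ t ≤ s + n, A.history (.oblivious v) ω t = A.history (.oblivious w) ω t := by
      intro t
      induction t with
      | zero => intro _; rfl
      | succ t ih =>
        intro ht
        have ih := ih (by omega)
        by_cases hts : t < s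
        · exact history_congr (fun _ _ => rfl) fun r hr => by
            funext _
            exact hlt r (by omega)
        · obtain ⟨j, rfl⟩ := Nat.exists_eq_add_of_le (not_lt.1 hts)
          have hpv := hp j (by omega)
          have heq : A.postedPrice (.oblivious v) ω (s + j) =
              A.postedPrice (.oblivious w) ω (s + j) := by
            rw [postedPrice, ih, ← postedPrice]
          have h1 := hpv.trans_eq (hv (s + j) (by omega) (by omega)).symm
          have h2 := hpv.trans (hw (s + j) (by omega) (by omega))
          rw [heq] at h1 h2
          simp only [history_succ, ih, heq, buyerValue_oblivious, h1, h2]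
    refine (min_le_right _ _).trans ((Finset.sum_le_sum fun j hj => ?_).trans
      (le_add_of_nonneg_left (nonneg v)))
    have hj := Finset.mem_range.1 hj
    have hpj := hp j hj
    rw [postedPrice, hh (s + j) (by omega), ← postedPrice] at hpj
    have h2 := hpj.trans (hw (s + j) (by omega) (by omega))
    rw [roundLoss_of_le h2, buyerValue_oblivious]
    have : (A.postedPrice (.oblivious w) ω (s + j) : ℝ) ≤ b := hpj
    linarith

theorem min_le_integral_cumulativeLoss_sub_add (A : PricingAlgorithm) {v w : ℕ → unitInterval}
    {s n : ℕ} {b : unitInterval} (hlt : ∀ t < s, v t = w t)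
    (hv : ∀ t, s ≤ t → t < s + n → v t = b) (hw : ∀ t, s ≤ t → t < s + n → b ≤ w t) :
    min (b : ℝ) (∑ j ∈ Finset.range n, ((w (s + j) : ℝ) - b)) ≤
      (∫ ω, A.cumulativeLoss (.oblivious v) (s + n) ω ∂A.law -
        ∫ ω, A.cumulativeLoss (.oblivious v) s ω ∂A.law) +
      (∫ ω, A.cumulativeLoss (.oblivious w) (s + n) ω ∂A.law -
        ∫ ω, A.cumulativeLoss (.oblivious w) s ω ∂A.law) := by
  have hi (x : ℕ → unitInterval) (n : ℕ) := A.integrable_cumulativeLoss (.oblivious x) n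
  rw [← integral_sub' (hi _ _) (hi _ _), ← integral_sub' (hi _ _) (hi _ _),
    ← integral_add' ((hi _ _).sub (hi _ _)) ((hi _ _).sub (hi _ _))]
  have h := integral_mono (μ := A.law) (integrable_const
    (min (b : ℝ) (∑ j ∈ Finset.range n, ((w (s + j) : ℝ) - b))))
    (((hi v (s + n)).sub (hi v s)).add ((hi w (s + n)).sub (hi w s)))
    (fun ω => A.min_le_cumulativeLoss_sub_add hlt hv hw ω)
  simpa using h

end PricingAlgorithm

/-! ### Lower bound: tents and their concatenation -/

/-- The value sequence that follows `v`, except for an excursion from `1 / 2` up to `1 / 2 + h * e`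
and back, with slope `e`, starting at time `s`. -/
def withTent (v : ℕ → unitInterval) (e : ℝ) (h s : ℕ) (t : ℕ) : unitInterval :=
  if t < s then v t
  else Set.projIcc 0 1 zero_le_one (1 / 2 + e * max 0 (h - |(t : ℝ) - s - h|))

/-- The tent has height `e * h ≤ 1 / 2`, so the projection to the unit interval is inactive. -/
theorem withTent_coe {v : ℕ → unitInterval} {e : ℝ} {h s t : ℕ} (he : 0 ≤ e) (heh : e * h ≤ 1 / 2)
    (ht : s ≤ t) :
    (withTent v e h s t : ℝ) = 1 / 2 + e * max 0 (h - |(t : ℝ) - s - h|) := by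
  have h1 : 0 ≤ e * max 0 (h - |(t : ℝ) - s - h|) := mul_nonneg he (le_max_left _ _)
  have h2 : e * max 0 (h - |(t : ℝ) - s - h|) ≤ e * h :=
    mul_le_mul_of_nonneg_left (max_le (by positivity) (by linarith [abs_nonneg ((t : ℝ) - s - h)])) he
  rw [withTent, if_neg (not_lt.2 ht), Set.projIcc_of_mem _ ⟨by linarith, by linarith⟩]

theorem abs_withTent_succ_sub_le {v : ℕ → unitInterval} {e : ℝ} {h s : ℕ} (he : 0 ≤ e)
    (heh : e * h ≤ 1 / 2) (hv : ∀ t, |(v (t + 1) : ℝ) - v t| ≤ e)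
    (hs : ∀ t, s ≤ t → (v t : ℝ) = 1 / 2) (t : ℕ) :
    |(withTent v e h s (t + 1) : ℝ) - withTent v e h s t| ≤ e := by
  rcases lt_trichotomy (t + 1) s with ht | ht | ht
  -- The three cases are before, at and after the junction; at the junction the tent starts from `1
  -- / 2`, which is also the value of `v` there.
  · simpa [withTent, ht, (show t < s by omega)] using hv t
  · have h1 : (withTent v e h s (t + 1) : ℝ) = v (t + 1) := by
      rw [withTent_coe he heh ht.ge, hs _ ht.ge, ← ht]
      simp
    have h2 : withTent v e h s t = v t := by simp [withTent, (show t < s by omega)]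
    rw [h1, h2]
    exact hv t
  · rw [withTent_coe he heh ht.le, withTent_coe he heh (by omega), add_sub_add_left_eq_sub,
      ← mul_sub, abs_mul, abs_of_nonneg he]
    rw [max_comm 0, max_comm 0]
    refine mul_le_of_le_one_right he ((abs_max_sub_max_le_abs _ _ _).trans ?_)
    rw [sub_sub_sub_cancel_left]
    refine (abs_abs_sub_abs_le _ _).trans (le_of_eq ?_)
    push_cast
    rw [show (t : ℝ) - s - h - ((t : ℝ) + 1 - s - h) = -1 by ring]
    simp

theorem sum_withTent_sub_half {v : ℕ → unitInterval} {e : ℝ} {h s : ℕ} (he : 0 ≤ e)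
    (heh : e * h ≤ 1 / 2) :
    ∑ j ∈ Finset.range (2 * h), ((withTent v e h s (s + j) : ℝ) - 1 / 2) = e * h ^ 2 := by
  simp only [withTent_coe he heh (Nat.le_add_right _ _), add_sub_cancel_left, ← Finset.mul_sum]
  -- Round `j` of the ascent is paired with round `j` of the descent: `j + (h - j) = h`.
  rw [two_mul, Finset.sum_range_add, ← Finset.sum_add_distrib,
    Finset.sum_congr rfl (g := fun _ => (h : ℝ)), Finset.sum_const, Finset.card_range, nsmul_eq_mul, sq]
  intro j hj
  have hj : (j : ℝ) ≤ h := by exact_mod_cast (Finset.mem_range.1 hj).le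
  have hj0 : (0 : ℝ) ≤ j := by positivity
  push_cast
  rw [abs_of_nonpos (by linarith), abs_of_nonneg (by linarith), max_eq_right (by linarith),
    max_eq_right (by linarith)]
  ring

theorem withTent_eq_half {v : ℕ → unitInterval} {e : ℝ} {h s t : ℕ} (he : 0 ≤ e)
    (heh : e * h ≤ 1 / 2) (ht : s + 2 * h ≤ t) : (withTent v e h s t : ℝ) = 1 / 2 := by
  have ht' : (s : ℝ) + 2 * h ≤ t := by exact_mod_cast ht
  have h0 : (0 : ℝ) ≤ h := by positivity
  rw [withTent_coe he heh (by omega), abs_of_nonneg (by linarith), max_eq_left (by linarith)]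
  simp

/-- Concatenating flat blocks and tents, each chosen to be the worse one for the algorithm. -/
theorem exists_oblivious_blocks (A : PricingAlgorithm) {e : ℝ} {h : ℕ} (he : 0 ≤ e)
    (heh : e * h ≤ 1 / 2) (heh2 : 1 / 4 ≤ e * h ^ 2) (m : ℕ) :
    ∃ v : ℕ → unitInterval, (∀ t, |(v (t + 1) : ℝ) - v t| ≤ e) ∧
      (∀ t, m * (2 * h) ≤ t → (v t : ℝ) = 1 / 2) ∧
      (m : ℝ) / 8 ≤ ∫ ω, A.cumulativeLoss (.oblivious v) (m * (2 * h)) ω ∂A.law := by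
  induction m with
  | zero =>
    refine ⟨fun _ => ⟨1 / 2, by norm_num, by norm_num⟩, fun t => by simpa using he, fun t _ => rfl, ?_⟩
    simp [PricingAlgorithm.cumulativeLoss]
  | succ m ih =>
    obtain ⟨v, hv, hs, hloss⟩ := ih
    set s := m * (2 * h) with hsdef
    have hsucc : (m + 1) * (2 * h) = s + 2 * h := by rw [hsdef]; ring
    rw [hsucc]
    have hlt : ∀ t < s, v t = withTent v e h s t := fun t ht => by simp [withTent, ht]
    have hmin := A.min_le_integral_cumulativeLoss_sub_add (w := withTent v e h s) (n := 2 * h)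
      (b := ⟨1 / 2, by norm_num, by norm_num⟩) hlt (fun t ht _ => Subtype.ext (hs t ht))
      (fun t ht _ => Subtype.coe_le_coe.1 <| by
        rw [withTent_coe he heh ht]
        exact le_add_of_nonneg_right (mul_nonneg he (le_max_left _ _)))
    rw [← integral_congr_ae (.of_forall fun ω => A.cumulativeLoss_oblivious_congr hlt ω)] at hmin
    simp only [sum_withTent_sub_half he heh] at hmin
    have hq : (1 / 4 : ℝ) ≤ min (1 / 2) (e * h ^ 2) := le_min (by norm_num) heh2
    -- The two continuations together lose at least `1 / 4` in this block after a common past, so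
    -- the worse one adds at least `1 / 8`.
    rcases le_total (∫ ω, A.cumulativeLoss (.oblivious v) (s + 2 * h) ω ∂A.law)
      (∫ ω, A.cumulativeLoss (.oblivious (withTent v e h s)) (s + 2 * h) ω ∂A.law) with hle | hle
    · refine ⟨withTent v e h s, abs_withTent_succ_sub_le he heh hv hs,
        fun t ht => withTent_eq_half he heh ht, ?_⟩
      push_cast
      linarith
    · refine ⟨v, hv, fun t ht => hs t (by omega), ?_⟩
      push_cast
      linarith

/-- The case of few rounds: a constant value `1 / 2` or `3 / 4`. -/
theorem exists_oblivious_const (A : PricingAlgorithm) (T : ℕ) :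
    ∃ v : ℕ → unitInterval, (∀ t, (v (t + 1) : ℝ) = v t) ∧
      min (1 / 4) ((T : ℝ) / 8) ≤ ∫ ω, A.cumulativeLoss (.oblivious v) T ω ∂A.law := by
  have hmin := A.min_le_integral_cumulativeLoss_sub_add (s := 0) (n := T)
    (v := fun _ => ⟨1 / 2, by norm_num, by norm_num⟩) (w := fun _ => ⟨3 / 4, by norm_num, by norm_num⟩)
    (b := ⟨1 / 2, by norm_num, by norm_num⟩) (fun t ht => absurd ht (Nat.not_lt_zero t))
    (fun _ _ _ => rfl) (fun _ _ _ => Subtype.coe_le_coe.1 (by norm_num))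
  simp only [zero_add, PricingAlgorithm.cumulativeLoss, Finset.range_zero, Finset.sum_empty,
    integral_zero, sub_zero, Finset.sum_const, Finset.card_range, nsmul_eq_mul] at hmin
  have hq : 2 * min (1 / 4) ((T : ℝ) / 8) ≤ min (1 / 2) ((T : ℝ) * (3 / 4 - 1 / 2)) := by
    have h1 := min_le_left (1 / 4) ((T : ℝ) / 8)
    have h2 := min_le_right (1 / 4) ((T : ℝ) / 8)
    exact le_min (by linarith) (by linarith)
  rcases le_total
    (∫ ω, A.cumulativeLoss (.oblivious fun _ => ⟨1 / 2, by norm_num, by norm_num⟩) T ω ∂A.law)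
    (∫ ω, A.cumulativeLoss (.oblivious fun _ => ⟨3 / 4, by norm_num, by norm_num⟩) T ω ∂A.law)
    with hle | hle
  · refine ⟨fun _ => ⟨3 / 4, by norm_num, by norm_num⟩, fun _ => rfl, ?_⟩
    simp only [PricingAlgorithm.cumulativeLoss] at hle ⊢
    linarith
  · refine ⟨fun _ => ⟨1 / 2, by norm_num, by norm_num⟩, fun _ => rfl, ?_⟩
    simp only [PricingAlgorithm.cumulativeLoss] at hle ⊢
    linarith

/-- The rounded-up `h` satisfies `1 / 2 ≤ √e * h ≤ 1`, so a tent has area at least `1 / 4`, while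
`√e ≤ 1 / 4` keeps its height below `1 / 2`. If not even one block fits into `T` rounds, constant
values suffice. -/
theorem exists_oblivious_sqrt_le_of_le (A : PricingAlgorithm) {T : ℕ} (hT : 1 ≤ T) {e : ℝ}
    (he : 0 < e) (he' : e ≤ 1 / 16) :
    ∃ v : ℕ → unitInterval, (∀ t, |(v (t + 1) : ℝ) - v t| ≤ e) ∧
      √e / 32 ≤ A.expectedRevenueLoss (.oblivious v) T := by
  have hr : 0 < √e := Real.sqrt_pos.2 he
  have hsq : √e * √e = e := Real.mul_self_sqrt he.le
  have hr4 : √e ≤ 1 / 4 := by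
    rw [Real.sqrt_le_left (by norm_num)]
    linarith
  set h := ⌈1 / (2 * √e)⌉₊ with hh
  have hhalf : √e * (1 / (2 * √e)) = 1 / 2 := by
    field_simp
  have hlow : 1 / 2 ≤ √e * h := by
    have := mul_le_mul_of_nonneg_left (Nat.le_ceil (1 / (2 * √e))) hr.le
    rwa [hhalf, ← hh] at this
  have hup : √e * h ≤ 1 := by
    have := mul_le_mul_of_nonneg_left
      (Nat.ceil_lt_add_one (by positivity : 0 ≤ 1 / (2 * √e))).le hr.le
    rw [← hh, mul_add, hhalf] at this
    linarith
  have hT0 : (0 : ℝ) < T := by exact_mod_cast hT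
  have hh0 : 0 < h := Nat.ceil_pos.2 (by positivity)
  simp only [A.expectedRevenueLoss_eq_integral_cumulativeLoss_div, le_div_iff₀ hT0]
  rcases lt_or_ge T (2 * h) with hlt | hge
  · obtain ⟨v, hv, hloss⟩ := exists_oblivious_const A T
    refine ⟨v, fun t => by rw [hv t, sub_self, abs_zero]; exact he.le, le_trans (le_min ?_ ?_) hloss⟩
    · have : (T : ℝ) ≤ 2 * h := by exact_mod_cast hlt.le
      nlinarith
    · nlinarith
  · obtain ⟨v, hv, -, hloss⟩ := exists_oblivious_blocks A he.le (h := h) (by nlinarith) (by nlinarith)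
      (T / (2 * h))
    refine ⟨v, hv, ?_⟩
    -- Dropping the incomplete last block at most halves the number of rounds, since there is at
    -- least one full block.
    have hm : (T : ℝ) ≤ (T / (2 * h) : ℕ) * (4 * h) := by
      have h1 : 1 ≤ T / (2 * h) := (Nat.one_le_div_iff (by omega)).2 hge
      have h2 := Nat.div_add_mod T (2 * h)
      have h3 := Nat.mod_lt T (show 0 < 2 * h by omega)
      have : T ≤ (T / (2 * h)) * (4 * h) := by nlinarith
      exact_mod_cast this
    have hmono : ∫ ω, A.cumulativeLoss (.oblivious v) (T / (2 * h) * (2 * h)) ω ∂A.law ≤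
        ∫ ω, A.cumulativeLoss (.oblivious v) T ω ∂A.law :=
      integral_mono (A.integrable_cumulativeLoss _ _) (A.integrable_cumulativeLoss _ _) fun ω =>
        Finset.sum_le_sum_of_subset_of_nonneg
          (Finset.range_mono (Nat.div_mul_le_self T (2 * h)))
          fun _ _ _ => A.roundLoss_nonneg _ ω _
    have hm0 : (0 : ℝ) ≤ (T / (2 * h) : ℕ) := Nat.cast_nonneg _
    have : √e / 32 * T ≤ (T / (2 * h) : ℕ) / 8 := by
      calc √e / 32 * T ≤ √e / 32 * ((T / (2 * h) : ℕ) * (4 * h)) :=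
            mul_le_mul_of_nonneg_left hm (by positivity)
        _ = (T / (2 * h) : ℕ) / 8 * (√e * h) := by ring
        _ ≤ (T / (2 * h) : ℕ) / 8 := mul_le_of_le_one_right (by positivity) hup
    linarith

theorem exists_oblivious_sqrt_le (A : PricingAlgorithm) {T : ℕ} (hT : 1 ≤ T) {e : ℝ}
    (he : 0 ≤ e) (he' : e ≤ 1) :
    ∃ v : ℕ → unitInterval, (∀ t, |(v (t + 1) : ℝ) - v t| ≤ e) ∧
      √e / 128 ≤ A.expectedRevenueLoss (.oblivious v) T := by
  rcases he.eq_or_lt with rfl | he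
  · refine ⟨fun _ => 0, fun t => by simp, ?_⟩
    rw [Real.sqrt_zero, zero_div]
    exact integral_nonneg fun ω => div_nonneg
      (Finset.sum_nonneg fun t _ => A.roundLoss_nonneg _ ω t) (Nat.cast_nonneg _)
  -- Slowing down by the factor `16` meets the smallness condition and costs a factor `4` in the
  -- square root.
  · obtain ⟨v, hv, hloss⟩ := exists_oblivious_sqrt_le_of_le A hT (e := e / 16) (by positivity)
      (by linarith)
    refine ⟨v, fun t => (hv t).trans (by linarith), le_trans (le_of_eq ?_) hloss⟩
    rw [Real.sqrt_div he.le, show (16 : ℝ) = 4 ^ 2 by norm_num, Real.sqrt_sq (by norm_num)]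
    ring

/-! ### Upper bound: the tracker and its potential -/

/-- The three kinds of prices that the tracking algorithm posts: the upper end, the midpoint or the
lower end of the interval in which it believes the value to be. -/
inductive Probe
  | check
  | bisect
  | exploit

/-- The memory of the tracking algorithm: it works under the hypothesis that the changing rate is
at most `(1 / 4) ^ level`, under which the value lies in the interval from `lo` to `hi`. -/
structure Tracker where
  level : ℕ
  lo : ℝ
  hi : ℝ

namespace Tracker

/-- The tracker of a given level that knows nothing about the value. -/
def fresh (i : ℕ) : Tracker := ⟨i, 0, 1⟩

/-- The price posted for a given kind of probe. -/
def price (S : Tracker) : Probe → ℝ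
  | .check => S.hi
  | .bisect => (S.lo + S.hi) / 2
  | .exploit => S.lo

/-- Replace the interval and widen it by the supposed changing rate. -/
def widen (S : Tracker) (lo hi : ℝ) : Tracker :=
  ⟨S.level, max 0 (lo - (1 / 4) ^ S.level), min 1 (hi + (1 / 4) ^ S.level)⟩

/-- The update after a sale signal. Signals that refute the supposed changing rate
make the tracker fall back to the previous level. -/
def respond (S : Tracker) : Probe → Bool → Tracker
  -- A sale at the upper end refutes the hypothesis only if that end is below `1`; this matches the
  -- exception in `Brackets`.
  | .check, true => if S.hi < 1 then fresh (S.level - 1) else S.widen S.lo S.hi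
  | .check, false => S.widen S.lo S.hi
  | .bisect, true => S.widen ((S.lo + S.hi) / 2) S.hi
  | .bisect, false => S.widen S.lo ((S.lo + S.hi) / 2)
  | .exploit, true => S.widen S.lo S.hi
  | .exploit, false => fresh (S.level - 1)

/-- The interval of the tracker is a subinterval of the unit interval. -/
def Valid (S : Tracker) : Prop := 0 ≤ S.lo ∧ S.lo ≤ S.hi ∧ S.hi ≤ 1

/-- The value lies in the interval of the tracker, excluding the upper end unless it is `1`. -/
def Brackets (S : Tracker) (v : ℝ) : Prop := S.lo ≤ v ∧ (v < S.hi ∨ S.hi = 1)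

/-- The potential that pays for the future losses due to wide intervals and to levels that are
too high. -/
def potential (S : Tracker) : ℝ := 2 ^ S.level * (16 + 8 * (S.hi - S.lo))

theorem valid_fresh (i : ℕ) : (fresh i).Valid := ⟨le_rfl, zero_le_one, le_rfl⟩

theorem brackets_fresh (i : ℕ) {v : ℝ} (hv : 0 ≤ v) : (fresh i).Brackets v := ⟨hv, .inr rfl⟩

theorem potential_fresh (i : ℕ) : (fresh i).potential = 2 ^ i * 24 := by
  norm_num [fresh, potential]

theorem Valid.price_mem {S : Tracker} (h : S.Valid) (a : Probe) : S.price a ∈ Set.Icc (0 : ℝ) 1 := by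
  obtain ⟨h0, h1, h2⟩ := h
  cases a <;> constructor <;> simp only [price] <;> linarith

theorem Valid.potential_nonneg {S : Tracker} (h : S.Valid) : 0 ≤ S.potential :=
  mul_nonneg (by positivity) (by linarith [h.2.1])

theorem Valid.le_potential {S : Tracker} (h : S.Valid) : 2 ^ S.level * 16 ≤ S.potential :=
  mul_le_mul_of_nonneg_left (by linarith [h.2.1]) (by positivity)

theorem valid_widen (S : Tracker) {lo hi : ℝ} (h0 : 0 ≤ lo) (h1 : lo ≤ hi) (h2 : hi ≤ 1) :
    (S.widen lo hi).Valid := by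
  have hx : (0 : ℝ) ≤ (1 / 4) ^ S.level := by positivity
  refine ⟨le_max_left _ _, max_le (le_min zero_le_one (by linarith)) (le_min ?_ ?_), min_le_left _ _⟩
    <;> linarith

/-- Widening by `4^(-level)` on both sides costs `2^level * 8 * 2 * 4^(-level)`; clipping to the
unit interval only helps. -/
theorem potential_widen_le (S : Tracker) (lo hi : ℝ) :
    (S.widen lo hi).potential ≤ 2 ^ S.level * (16 + 8 * (hi - lo)) + 16 * (1 / 2) ^ S.level := by
  have h1 := le_max_right 0 (lo - (1 / 4) ^ S.level)
  have h2 := min_le_right 1 (hi + (1 / 4) ^ S.level)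
  have h3 : (2 : ℝ) ^ S.level * (1 / 4) ^ S.level = (1 / 2) ^ S.level := by
    rw [← mul_pow]
    norm_num
  calc (S.widen lo hi).potential
      ≤ 2 ^ S.level * (16 + 8 * ((hi + (1 / 4) ^ S.level) - (lo - (1 / 4) ^ S.level))) := by
        refine mul_le_mul_of_nonneg_left ?_ (by positivity)
        simp only [widen]
        linarith
    _ = _ := by
        linear_combination 16 * h3

theorem potential_widen_self_le (S : Tracker) :
    (S.widen S.lo S.hi).potential ≤ S.potential + 16 * (1 / 2) ^ S.level :=
  S.potential_widen_le _ _

theorem potential_widen_lower_half (S : Tracker) :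
    (S.widen S.lo ((S.lo + S.hi) / 2)).potential ≤
      S.potential - 2 ^ S.level * (4 * (S.hi - S.lo)) + 16 * (1 / 2) ^ S.level := by
  refine (S.potential_widen_le _ _).trans (le_of_eq ?_)
  rw [potential]
  ring

theorem potential_widen_upper_half (S : Tracker) :
    (S.widen ((S.lo + S.hi) / 2) S.hi).potential ≤
      S.potential - 2 ^ S.level * (4 * (S.hi - S.lo)) + 16 * (1 / 2) ^ S.level := by
  refine (S.potential_widen_le _ _).trans (le_of_eq ?_)
  rw [potential]
  ring

/-- The weight `16` of the level pays for forgetting the interval: `24 * 2^(i - 1) = 12 * 2^i`,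
which leaves `4 * 2^i` to spare. -/
theorem Valid.potential_fallback_le {S : Tracker} (h : S.Valid) (hS : S.level ≠ 0) :
    (fresh (S.level - 1)).potential ≤ S.potential - 2 ^ S.level * 4 := by
  obtain ⟨i, hi⟩ := Nat.exists_eq_succ_of_ne_zero hS
  have := h.le_potential
  rw [potential_fresh]
  rw [hi, Nat.succ_eq_add_one, pow_succ] at *
  rw [Nat.add_sub_cancel]
  linarith

theorem Brackets.widen {S : Tracker} {lo hi v v' : ℝ} (h1 : lo ≤ v) (h2 : v < hi ∨ hi = 1)
    (hv' : 0 ≤ v') (h : |v' - v| ≤ (1 / 4) ^ S.level) : (S.widen lo hi).Brackets v' := by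
  have hx : (0 : ℝ) ≤ (1 / 4) ^ S.level := by positivity
  have h := abs_le.1 h
  refine ⟨max_le hv' (by linarith [h.1]), ?_⟩
  rcases le_total 1 (hi + (1 / 4) ^ S.level) with h3 | h3
  · exact .inr (min_eq_left h3)
  · rcases h2 with h2 | rfl
    · refine .inl ?_
      simp only [Tracker.widen, min_eq_right h3]
      linarith [h.2]
    · exact .inr (min_eq_left (by linarith))

/-- The loss of a probe against a value plus the potential of the resulting tracker. -/
def cost (S : Tracker) (v : ℝ) (a : Probe) : ℝ :=
  (v - if S.price a ≤ v then S.price a else 0) + (S.respond a (decide (S.price a ≤ v))).potential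

theorem cost_of_le {S : Tracker} {v : ℝ} {a : Probe} (h : S.price a ≤ v) :
    S.cost v a = v - S.price a + (S.respond a true).potential := by
  simp [cost, h]

theorem cost_of_lt {S : Tracker} {v : ℝ} {a : Probe} (h : v < S.price a) :
    S.cost v a = v + (S.respond a false).potential := by
  simp [cost, not_le.2 h]

/-- Either answer halves the interval, so the bound needs no bracketing. -/
theorem cost_bisect_le {S : Tracker} (hS : S.Valid) {v : ℝ} (hv : v ≤ 1) :
    S.cost v .bisect ≤
      1 + S.potential - 2 ^ S.level * (4 * (S.hi - S.lo)) + 16 * (1 / 2) ^ S.level := by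
  rcases le_or_gt (S.price .bisect) v with h | h
  · rw [cost_of_le h]
    have := (hS.price_mem .bisect).1
    have := potential_widen_upper_half S
    simp only [respond]
    linarith
  · rw [cost_of_lt h]
    have := potential_widen_lower_half S
    simp only [respond]
    linarith

theorem cost_check_le_of_lt {S : Tracker} {v : ℝ} (hv : v ≤ 1) (h : v < S.hi) :
    S.cost v .check ≤ 1 + S.potential + 16 * (1 / 2) ^ S.level := by
  rw [cost_of_lt h]
  have := potential_widen_self_le S
  simp only [respond]
  linarith

theorem cost_exploit_le_of_le {S : Tracker} {v : ℝ} (h : S.lo ≤ v) :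
    S.cost v .exploit ≤ v - S.lo + S.potential + 16 * (1 / 2) ^ S.level := by
  rw [cost_of_le h]
  have := potential_widen_self_le S
  simp only [respond, price]
  linarith

/-- The potential pays for the expected loss of a round in which the tracker checks and bisects
with probability `δ = (1 / 2) ^ level / 4` each. -/
theorem expected_cost_le {S : Tracker} (hS : S.Valid) {v δ : ℝ} (h1 : v ≤ 1)
    (hb : ¬ S.Brackets v → S.level ≠ 0) (hδ : 4 * δ = (1 / 2) ^ S.level) :
    δ * S.cost v .check + δ * S.cost v .bisect + (1 - 2 * δ) * S.cost v .exploit ≤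
      S.potential + 17 * (1 / 2) ^ S.level := by
  have hq : (1 : ℝ) ≤ 2 ^ S.level := one_le_pow₀ one_le_two
  have hqd : 2 ^ S.level * δ = 1 / 4 := by
    have : (2 : ℝ) ^ S.level * (1 / 2) ^ S.level = 1 := by
      rw [← mul_pow]
      norm_num
    linear_combination (2 ^ S.level / 4) * hδ + this / 4
  have hδ0 : 0 < δ := by
    have : (0 : ℝ) < (1 / 2) ^ S.level := by positivity
    linarith
  have hδ1 : δ ≤ 1 / 4 := by nlinarith
  have hbis := cost_bisect_le hS h1
  rw [← hδ] at hbis ⊢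
  have hW : 0 ≤ S.hi - S.lo := by linarith [hS.2.1]
  have hbis' := mul_le_mul_of_nonneg_left hbis hδ0.le
  -- The expected drop from bisecting is `δ * 2 ^ level * 4 * W = W`, exactly what exploiting may
  -- lose below.
  have hbis'' : δ * S.cost v .bisect ≤
      δ * (1 + S.potential + 16 * (4 * δ)) - (S.hi - S.lo) := by
    refine hbis'.trans (le_of_eq ?_)
    linear_combination (-4 * (S.hi - S.lo)) * hqd
  by_cases hB : S.Brackets v
  · have hexp := cost_exploit_le_of_le hB.1
    have hvW : v - S.lo ≤ S.hi - S.lo := by rcases hB.2 with h | h <;> linarith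
    have hchk : S.cost v .check ≤ 1 + S.potential + 16 * (1 / 2) ^ S.level := by
      rcases lt_or_ge v S.hi with h | h
      · exact cost_check_le_of_lt h1 h
      · have hhi := hB.2.resolve_left (not_lt.2 h)
        rw [cost_of_le h]
        have := potential_widen_self_le S
        simp only [respond, price, hhi, lt_irrefl, if_false] at this ⊢
        linarith
    rw [← hδ] at hexp hchk
    have hexp' := mul_le_mul_of_nonneg_left
      (hexp.trans (by linarith : _ ≤ S.hi - S.lo + S.potential + 16 * (4 * δ)))
      (by linarith : 0 ≤ 1 - 2 * δ)
    have hchk' := mul_le_mul_of_nonneg_left hchk hδ0.le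
    nlinarith [mul_nonneg hδ0.le hW]
  -- The value is outside: a fallback of probability at least `δ` lowers the expected potential by
  -- at least `1`, which pays for any loss. A value too high is detected by checking, a value too
  -- low by exploiting.
  · have hlev := hb hB
    have hfall := hS.potential_fallback_le hlev
    by_cases hlo : S.lo ≤ v
    · have hhi : S.hi ≤ v ∧ S.hi < 1 := by
        by_contra hcon
        refine hB ⟨hlo, ?_⟩
        rcases lt_or_ge v S.hi with h | h
        · exact .inl h
        · exact .inr (le_antisymm hS.2.2 (not_lt.1 fun h' => hcon ⟨h, h'⟩))
      have hexp := cost_exploit_le_of_le hlo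
      have hchk : S.cost v .check ≤ 1 + S.potential - 2 ^ S.level * 4 := by
        rw [cost_of_le hhi.1]
        simp only [respond, price, hhi.2, if_true]
        linarith [hS.1, hS.2.1]
      rw [← hδ] at hexp
      have hexp' := mul_le_mul_of_nonneg_left
        (hexp.trans (by linarith [hS.1] : _ ≤ 1 + S.potential + 16 * (4 * δ)))
        (by linarith : 0 ≤ 1 - 2 * δ)
      have hchk' := mul_le_mul_of_nonneg_left hchk hδ0.le
      nlinarith
    · have hexp : S.cost v .exploit ≤ 1 + S.potential - 2 ^ S.level * 4 := by
        rw [cost_of_lt (not_le.1 hlo)]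
        simp only [respond]
        linarith
      have hchk := cost_check_le_of_lt h1 ((not_le.1 hlo).trans_le hS.2.1)
      rw [← hδ] at hchk
      have hexp' := mul_le_mul_of_nonneg_left hexp (by linarith : 0 ≤ 1 - 2 * δ)
      have hchk' := mul_le_mul_of_nonneg_left hchk hδ0.le
      nlinarith

/-! ### Upper bound: only false hypotheses are refuted -/

/-- The invariant of the tracker during an epoch with changing rates at most `r`, where the level
was `K` in the beginning. -/
structure Invariant (K : ℕ) (r : ℝ) (S : Tracker) (v : ℝ) : Prop where
  level_le : S.level ≤ K
  valid : S.Valid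
  brackets : r ≤ (1 / 4) ^ S.level → S.Brackets v
  lt_rate : S.level = K ∨ (1 / 4) ^ (S.level + 1) < r

theorem invariant_fresh (K : ℕ) (r : ℝ) {v : ℝ} (hv : 0 ≤ v) : Invariant K r (fresh K) v :=
  ⟨le_rfl, valid_fresh K, fun _ => brackets_fresh K hv, .inl rfl⟩

/-- Below the starting level, the next higher level was refuted, so its rate is less than `r`;
taking roots loses one factor `2`. -/
theorem Invariant.half_pow_level_le {K : ℕ} {r : ℝ} {S : Tracker} {v : ℝ} (h : Invariant K r S v) :
    (1 / 2 : ℝ) ^ S.level ≤ 2 * √r + (1 / 2) ^ K := by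
  rcases h.lt_rate with h | h
  · rw [h]
    linarith [Real.sqrt_nonneg r]
  · have h2 : (1 / 2 : ℝ) ^ (S.level + 1) ≤ √r := by
      refine Real.le_sqrt_of_sq_le (le_trans (le_of_eq ?_) h.le)
      rw [← pow_mul, mul_comm, pow_mul]
      norm_num
    rw [pow_succ] at h2
    have : (0 : ℝ) ≤ (1 / 2) ^ K := by positivity
    linarith

/-- Level `0` supposes only rates at most `1` and cannot be refuted, so the truncated `level - 1` in
`respond` does no harm. -/
theorem Invariant.level_ne_zero {K : ℕ} {r : ℝ} {S : Tracker} {v : ℝ} (h : Invariant K r S v)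
    (hr : r ≤ 1) (hB : ¬ S.Brackets v) : S.level ≠ 0 := fun h0 =>
  hB (h.brackets (by rwa [h0, pow_zero]))

theorem Invariant.fallback {K : ℕ} {r : ℝ} {S : Tracker} {v v' : ℝ} (h : Invariant K r S v)
    (hr : r ≤ 1) (hB : ¬ S.Brackets v) (hv' : 0 ≤ v') : Invariant K r (fresh (S.level - 1)) v' := by
  have h0 := h.level_ne_zero hr hB
  refine ⟨(Nat.sub_le _ _).trans h.level_le, valid_fresh _, fun _ => brackets_fresh _ hv', .inr ?_⟩
  have : S.level - 1 + 1 = S.level := by omega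
  simp only [fresh, this]
  exact not_le.1 fun hle => hB (h.brackets hle)

theorem Invariant.widen {K : ℕ} {r : ℝ} {S : Tracker} {v v' lo hi : ℝ} (h : Invariant K r S v)
    (hv' : 0 ≤ v') (hvv' : |v' - v| ≤ r) (hlo : S.lo ≤ lo) (hlohi : lo ≤ hi) (hhi : hi ≤ S.hi)
    (hB : S.Brackets v → lo ≤ v ∧ (v < hi ∨ hi = 1)) : Invariant K r (S.widen lo hi) v' :=
  ⟨h.level_le, S.valid_widen (h.valid.1.trans hlo) hlohi (hhi.trans h.valid.2.2),
    fun hr => Brackets.widen (hB (h.brackets hr)).1 (hB (h.brackets hr)).2 hv' (hvv'.trans hr),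
    h.lt_rate⟩

theorem Invariant.respond {K : ℕ} {r : ℝ} {S : Tracker} {v v' : ℝ} (h : Invariant K r S v)
    (hr : r ≤ 1) (hv' : 0 ≤ v') (hvv' : |v' - v| ≤ r) (a : Probe) :
    Invariant K r (S.respond a (decide (S.price a ≤ v))) v' := by
  have hle := h.valid.2.1
  have hself := h.widen hv' hvv' le_rfl hle le_rfl id
  by_cases hp : S.price a ≤ v <;> simp only [hp, decide_true, decide_false] <;> cases a <;>
    simp only [Tracker.respond] <;> simp only [price] at hp
  · split_ifs with hhi
    · exact h.fallback hr (fun hB => hB.2.elim (not_lt.2 hp) hhi.ne) hv'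
    · exact hself
  · exact h.widen hv' hvv' (by linarith) (by linarith) le_rfl fun hB => ⟨hp, hB.2⟩
  · exact hself
  · exact hself
  · exact h.widen hv' hvv' le_rfl (by linarith) (by linarith) fun hB => ⟨hB.1, .inl (not_le.1 hp)⟩
  · exact h.fallback hr (fun hB => hp hB.1) hv'

end Tracker

/-! ### Upper bound: random seeds and the algorithm -/

/-- The kind of probe selected by a uniform random number below `4 * 2 ^ K` at level `i`. -/
def probeOf (K i : ℕ) (w : Fin (4 * 2 ^ K)) : Probe :=
  if (w : ℕ) < 2 ^ (K - i) then .check else if (w : ℕ) < 2 * 2 ^ (K - i) then .bisect else .exploit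

/-- Exactly `2 ^ (K - i)` of the `4 * 2 ^ K` numbers select each rare probe, so one finite seed
alphabet realises the probabilities of all levels up to `K`. -/
theorem sum_probeOf {K i : ℕ} (h : i ≤ K) (f : Probe → ℝ) :
    ∑ w, f (probeOf K i w) = (4 * 2 ^ K : ℕ) * ((1 / 2) ^ i / 4 * f .check + (1 / 2) ^ i / 4 * f .bisect +
      (1 - 2 * ((1 / 2) ^ i / 4)) * f .exploit) := by
  obtain ⟨j, rfl⟩ := Nat.exists_eq_add_of_le h
  simp only [probeOf, Nat.add_sub_cancel_left]
  rw [Fin.sum_univ_eq_sum_range (fun w => f (if w < 2 ^ j then .check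
    else if w < 2 * 2 ^ j then .bisect else .exploit)) (4 * 2 ^ (i + j))]
  have hN : 4 * 2 ^ (i + j) = 2 ^ j + (2 ^ j + (4 * 2 ^ (i + j) - 2 * 2 ^ j)) := by
    have : 2 ^ j ≤ 2 ^ (i + j) := Nat.pow_le_pow_right two_pos (by omega)
    omega
  have h1 : ∀ x ∈ Finset.range (2 ^ j), f (if x < 2 ^ j then .check
      else if x < 2 * 2 ^ j then .bisect else .exploit) = f .check := fun x hx => by
    rw [if_pos (Finset.mem_range.1 hx)]
  have h2 : ∀ x ∈ Finset.range (2 ^ j), f (if 2 ^ j + x < 2 ^ j then .check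
      else if 2 ^ j + x < 2 * 2 ^ j then .bisect else .exploit) = f .bisect := fun x hx => by
    have := Finset.mem_range.1 hx
    rw [if_neg (by omega), if_pos (by omega)]
  have h3 : ∀ x ∈ Finset.range (4 * 2 ^ (i + j) - 2 * 2 ^ j),
      f (if 2 ^ j + (2 ^ j + x) < 2 ^ j then .check
      else if 2 ^ j + (2 ^ j + x) < 2 * 2 ^ j then .bisect else .exploit) = f .exploit := fun x _ => by
    rw [if_neg (by omega), if_neg (by omega)]
  have hcast : ((4 * 2 ^ (i + j) - 2 * 2 ^ j : ℕ) : ℝ) = 4 * 2 ^ (i + j) - 2 * 2 ^ j := by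
    have : 2 * 2 ^ j ≤ 4 * 2 ^ (i + j) := by omega
    push_cast [Nat.cast_sub this]
    ring
  have hpow : (2 : ℝ) ^ (i + j) * (1 / 2) ^ i = 2 ^ j := by
    rw [pow_add, mul_right_comm, ← mul_pow]
    norm_num
  conv_lhs => rw [hN]
  rw [Finset.sum_range_add, Finset.sum_range_add, Finset.sum_congr rfl h1, Finset.sum_congr rfl h2,
    Finset.sum_congr rfl h3]
  simp only [Finset.sum_const, Finset.card_range, nsmul_eq_mul, hcast]
  push_cast
  linear_combination (2 * f .exploit - f .check - f .bisect) * hpow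

/-- Resampling one coordinate of a uniformly distributed function. -/
theorem card_mul_sum_eq_sum_sum_update {ι W : Type*} [Fintype ι] [DecidableEq ι] [Fintype W]
    (i : ι) (F : (ι → W) → ℝ) :
    Fintype.card W * ∑ ω, F ω = ∑ ω, ∑ w, F (Function.update ω i w) := by
  -- The involution exchanges coordinate `i` with the fresh sample.
  let σ : (ι → W) × W ≃ (ι → W) × W :=
    Function.Involutive.toPerm (fun x => (Function.update x.1 i x.2, x.1 i)) fun x => by simp
  rw [← Fintype.sum_prod_type' fun ω w => F (Function.update ω i w)]
  rw [← Equiv.sum_comp σ]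
  simp [σ, Function.Involutive.toPerm, Fintype.sum_prod_type, Finset.mul_sum]

/-- The tracker at time `t`, as a function of the random numbers and of the signals;
it starts afresh every `M` rounds. -/
def trackerState (K M : ℕ) (ω : ℕ → Fin (4 * 2 ^ K)) : (t : ℕ) → (Fin t → Bool) → Tracker
  | 0, _ => .fresh K
  | t + 1, σ =>
    let S := trackerState K M ω t (Fin.init σ)
    if (t + 1) % M = 0 then .fresh K
    else S.respond (probeOf K S.level (ω t)) (σ (Fin.last t))

theorem trackerState_succ {K M : ℕ} {ω : ℕ → Fin (4 * 2 ^ K)} {t : ℕ} {σ : Fin (t + 1) → Bool}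
    {σ' : Fin t → Bool} {b : Bool} (h : Fin.init σ = σ') (hb : σ (Fin.last t) = b) :
    trackerState K M ω (t + 1) σ = if (t + 1) % M = 0 then .fresh K else
      (trackerState K M ω t σ').respond (probeOf K (trackerState K M ω t σ').level (ω t)) b := by
  subst h hb
  rfl

theorem trackerState_congr {K M : ℕ} {ω ω' : ℕ → Fin (4 * 2 ^ K)} {t : ℕ}
    (h : ∀ s < t, ω s = ω' s) (σ : Fin t → Bool) :
    trackerState K M ω t σ = trackerState K M ω' t σ := by
  induction t with
  | zero => rfl
  | succ t ih =>
    simp only [trackerState, ih (fun s hs => h s (by omega)), h t (by omega)]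

/-- Extend a finite sequence of random numbers by zeros. -/
def extendSeed {T N : ℕ} [NeZero N] (ω : Fin T → Fin N) (t : ℕ) : Fin N :=
  if h : t < T then ω ⟨t, h⟩ else 0

theorem extendSeed_update_of_ne {T N : ℕ} [NeZero N] (ω : Fin T → Fin N) (i : Fin T) (w : Fin N)
    {t : ℕ} (ht : t ≠ i) : extendSeed (Function.update ω i w) t = extendSeed ω t := by
  unfold extendSeed
  split_ifs with h
  · exact Function.update_of_ne (fun h' => ht (by simp [← h'])) _ _
  · rfl

theorem extendSeed_update_self {T N : ℕ} [NeZero N] (ω : Fin T → Fin N) (i : Fin T) (w : Fin N) :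
    extendSeed (Function.update ω i w) i = w := by
  simp [extendSeed]

/-- The pricing algorithm for `T` rounds that starts a tracker of level `K` every `M` rounds. -/
def trackingAlgorithm (T K M : ℕ) : PricingAlgorithm where
  Seed := Fin T → Fin (4 * 2 ^ K)
  law := (PMF.uniformOfFintype _).toMeasure
  price t ω σ :=
    let S := trackerState K M (extendSeed ω) t σ
    Set.projIcc 0 1 zero_le_one (S.price (probeOf K S.level (extendSeed ω t)))
  measurable_price _ _ := .of_discrete

namespace trackingAlgorithm

variable {T K M : ℕ} {B : Adversary}

theorem integral_law (F : (Fin T → Fin (4 * 2 ^ K)) → ℝ) :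
    ∫ ω, F ω ∂(trackingAlgorithm T K M).law =
      (∑ ω, F ω) / Fintype.card (Fin T → Fin (4 * 2 ^ K)) := by
  refine (PMF.integral_eq_sum _ F).trans ?_
  simp only [PMF.uniformOfFintype_apply, ENNReal.toReal_inv, ENNReal.toReal_natCast, smul_eq_mul,
    ← Finset.mul_sum]
  exact inv_mul_eq_div _ _

variable (T K M B) in
/-- The tracker at time `t` when the algorithm faces the adversary. -/
def state (t : ℕ) (ω : Fin T → Fin (4 * 2 ^ K)) : Tracker :=
  trackerState K M (extendSeed ω) t fun s => ((trackingAlgorithm T K M).history B ω t s).2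

theorem postedPrice_eq (ω : Fin T → Fin (4 * 2 ^ K)) (t : ℕ) :
    (trackingAlgorithm T K M).postedPrice B ω t = Set.projIcc (0 : ℝ) 1 zero_le_one
      ((state T K M B t ω).price (probeOf K (state T K M B t ω).level (extendSeed ω t))) := rfl

theorem state_succ (ω : Fin T → Fin (4 * 2 ^ K)) (t : ℕ) :
    state T K M B (t + 1) ω = if (t + 1) % M = 0 then .fresh K else
      (state T K M B t ω).respond (probeOf K (state T K M B t ω).level (extendSeed ω t))
        (decide ((trackingAlgorithm T K M).postedPrice B ω t ≤
          (trackingAlgorithm T K M).buyerValue B ω t)) :=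
  trackerState_succ (PricingAlgorithm.init_signals_succ _ _ _ _)
    (PricingAlgorithm.last_signals_succ _ _ _ _)

theorem price_update_of_lt (ω : Fin T → Fin (4 * 2 ^ K)) (i : Fin T) (w : Fin (4 * 2 ^ K)) {t : ℕ}
    (ht : t < i) : (trackingAlgorithm T K M).price t (Function.update ω i w) =
      (trackingAlgorithm T K M).price t ω := by
  funext σ
  simp only [trackingAlgorithm, extendSeed_update_of_ne ω i w ht.ne,
    trackerState_congr (fun s hs => extendSeed_update_of_ne ω i w (hs.trans ht).ne) σ]

theorem history_update (ω : Fin T → Fin (4 * 2 ^ K)) (i : Fin T) (w : Fin (4 * 2 ^ K)) :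
    (trackingAlgorithm T K M).history B (Function.update ω i w) i =
      (trackingAlgorithm T K M).history B ω i :=
  PricingAlgorithm.history_congr (fun _ hs => price_update_of_lt ω i w hs) fun _ _ => rfl

theorem state_update (ω : Fin T → Fin (4 * 2 ^ K)) (i : Fin T) (w : Fin (4 * 2 ^ K)) :
    state T K M B i (Function.update ω i w) = state T K M B i ω := by
  rw [state, history_update,
    trackerState_congr fun s hs => extendSeed_update_of_ne ω i w hs.ne]
  rfl

theorem buyerValue_update (ω : Fin T → Fin (4 * 2 ^ K)) (i : Fin T) (w : Fin (4 * 2 ^ K)) :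
    (trackingAlgorithm T K M).buyerValue B (Function.update ω i w) i =
      (trackingAlgorithm T K M).buyerValue B ω i :=
  PricingAlgorithm.buyerValue_congr (history_update ω i w)

theorem postedPrice_le_iff {ω : Fin T → Fin (4 * 2 ^ K)} {t : ℕ}
    (h : (state T K M B t ω).Valid) :
    (trackingAlgorithm T K M).postedPrice B ω t ≤ (trackingAlgorithm T K M).buyerValue B ω t ↔
      (state T K M B t ω).price (probeOf K (state T K M B t ω).level (extendSeed ω t)) ≤
        (trackingAlgorithm T K M).buyerValue B ω t := by
  rw [postedPrice_eq, ← Subtype.coe_le_coe, Set.projIcc_of_mem _ (h.price_mem _)]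

/-- At a restart the fresh potential is charged in full and the discarded one, nonnegative by `hr`,
is dropped. -/
theorem roundLoss_add_potential_le {ω : Fin T → Fin (4 * 2 ^ K)} {t : ℕ}
    (h : (state T K M B t ω).Valid)
    (hr : ∀ a b, 0 ≤ ((state T K M B t ω).respond a b).potential) :
    (trackingAlgorithm T K M).roundLoss B ω t + (state T K M B (t + 1) ω).potential ≤
      (state T K M B t ω).cost ((trackingAlgorithm T K M).buyerValue B ω t)
        (probeOf K (state T K M B t ω).level (extendSeed ω t)) +
      if (t + 1) % M = 0 then 2 ^ K * 24 else 0 := by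
  have hloss : (trackingAlgorithm T K M).roundLoss B ω t =
      (trackingAlgorithm T K M).buyerValue B ω t -
        if (state T K M B t ω).price (probeOf K (state T K M B t ω).level (extendSeed ω t)) ≤
          (trackingAlgorithm T K M).buyerValue B ω t
        then (state T K M B t ω).price (probeOf K (state T K M B t ω).level (extendSeed ω t))
        else 0 := by
    split_ifs with hp
    · rw [PricingAlgorithm.roundLoss_of_le ((postedPrice_le_iff h).2 hp), postedPrice_eq,
        Set.projIcc_of_mem _ (h.price_mem _)]
    · rw [PricingAlgorithm.roundLoss_of_lt (not_le.1 (mt (postedPrice_le_iff h).1 hp)), sub_zero]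
  rw [hloss, state_succ, Tracker.cost, add_assoc]
  refine add_le_add_right ?_ _
  split_ifs with hM
  · rw [Tracker.potential_fresh]
    exact le_add_of_nonneg_left (hr _ _)
  · simp only [postedPrice_le_iff h, add_zero, le_refl]

end trackingAlgorithm

/-! ### Upper bound: summing over rounds and epochs -/

theorem sum_add_le_of_forall_sum_add_le {Ω : Type*} [Fintype Ω] (R Φ : ℕ → Ω → ℝ) (b : ℕ → ℝ)
    (n : ℕ) (h : ∀ t < n, ∑ ω, (R t ω + Φ (t + 1) ω) ≤ ∑ ω, (Φ t ω + b t)) :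
    ∑ ω, (∑ t ∈ Finset.range n, R t ω + Φ n ω) ≤
      ∑ ω, Φ 0 ω + Fintype.card Ω * ∑ t ∈ Finset.range n, b t := by
  induction n with
  | zero => simp
  | succ n ih =>
    have ih := ih fun t ht => h t (by omega)
    have h := h n (by omega)
    simp only [Finset.sum_range_succ, Finset.sum_add_distrib, Finset.sum_const, Finset.card_univ,
      nsmul_eq_mul, mul_add] at ih h ⊢
    linarith

theorem sum_range_ite_succ_mod (n M : ℕ) (c : ℝ) :
    ∑ t ∈ Finset.range n, (if (t + 1) % M = 0 then c else 0) = (n / M : ℕ) * c := by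
  induction n with
  | zero => simp
  | succ n ih =>
    rw [Finset.sum_range_succ, ih, Nat.succ_div]
    simp only [Nat.dvd_iff_mod_eq_zero]
    split_ifs
    · push_cast
      ring
    · simp

/-- The epoch containing round `M + t` starts after round `t`, so its initial rate is at most `ε t`.
The first `M` rounds contribute at most `1` each. -/
theorem sum_sqrt_epoch_start_le {ε : ℕ → ℝ} (hε : Antitone ε)
    (h1 : ∀ t, ε t ≤ 1) {M : ℕ} (hM : 0 < M) (T : ℕ) :
    ∑ t ∈ Finset.range T, √(ε (M * (t / M))) ≤ ∑ t ∈ Finset.range T, √(ε t) + M := by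
  have hle (t : ℕ) : √(ε t) ≤ 1 := Real.sqrt_le_one.2 (h1 t)
  rcases le_total T M with hTM | hTM
  · have : ∑ t ∈ Finset.range T, √(ε (M * (t / M))) ≤ ∑ t ∈ Finset.range T, (1 : ℝ) :=
      Finset.sum_le_sum fun t _ => hle _
    have h2 : (0 : ℝ) ≤ ∑ t ∈ Finset.range T, √(ε t) := Finset.sum_nonneg fun t _ => Real.sqrt_nonneg _
    have h3 : (T : ℝ) ≤ M := by exact_mod_cast hTM
    simp only [Finset.sum_const, Finset.card_range, nsmul_eq_mul, mul_one] at this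
    linarith
  · obtain ⟨d, rfl⟩ := Nat.exists_eq_add_of_le hTM
    rw [Finset.sum_range_add, add_comm]
    refine add_le_add ?_ ?_
    · refine le_trans ?_ (Finset.sum_le_sum_of_subset_of_nonneg
        (Finset.range_mono (Nat.le_add_left d M)) fun _ _ _ => Real.sqrt_nonneg _)
      refine Finset.sum_le_sum fun t _ => Real.sqrt_le_sqrt (hε ?_)
      have h2 := Nat.div_add_mod (M + t) M
      have h3 := Nat.mod_lt (M + t) hM
      omega
    · refine (Finset.sum_le_sum fun t _ => hle _).trans (le_of_eq ?_)
      simp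

theorem Tracker.Valid.respond {S : Tracker} (h : S.Valid) (a : Probe) (b : Bool) :
    (S.respond a b).Valid := by
  obtain ⟨g0, g1, g2⟩ := h
  cases a <;> cases b <;> simp only [Tracker.respond] <;> try split_ifs
  all_goals
    first
    | exact Tracker.valid_fresh _
    | exact S.valid_widen (by linarith) (by linarith) (by linarith)

namespace trackingAlgorithm

variable {T K M : ℕ} {B : Adversary} {ε : ℕ → ℝ}

/-- Since rates do not increase, the rate at the start of an epoch bounds all rates in it and serves
as `r`. -/
theorem invariant_state (hε : Antitone ε) (h1 : ∀ t, ε t ≤ 1)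
    (hB : B.HasChangingRate fun t : Fin T => ε t) (ω : Fin T → Fin (4 * 2 ^ K)) {t : ℕ} (ht : t < T) :
    Tracker.Invariant K (ε (M * (t / M))) (state T K M B t ω)
      ((trackingAlgorithm T K M).buyerValue B ω t) := by
  induction t with
  | zero => exact Tracker.invariant_fresh K _ (unitInterval.nonneg _)
  | succ t ih =>
    have ih := ih (by omega)
    rw [state_succ]
    split_ifs with hmod
    · exact Tracker.invariant_fresh K _ (unitInterval.nonneg _)
    · have hdiv : (t + 1) / M = t / M := Nat.succ_div_of_not_dvd fun h => hmod (Nat.mod_eq_zero_of_dvd h)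
      rw [hdiv]
      simp only [postedPrice_le_iff ih.valid]
      exact ih.respond (h1 _) (unitInterval.nonneg _)
        ((hB.abs_buyerValue_succ_sub_le (A := trackingAlgorithm T K M) ω ht).trans
          (hε (Nat.mul_div_le t M))) _

theorem sum_roundLoss_add_potential_le (hε : Antitone ε) (h1 : ∀ t, ε t ≤ 1)
    (hB : B.HasChangingRate fun t : Fin T => ε t) {t : ℕ} (ht : t < T) :
    ∑ ω : Fin T → Fin (4 * 2 ^ K), ((trackingAlgorithm T K M).roundLoss B ω t +
      (state T K M B (t + 1) ω).potential) ≤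
    ∑ ω, ((state T K M B t ω).potential + 17 * (2 * √(ε (M * (t / M))) + (1 / 2) ^ K) +
      if (t + 1) % M = 0 then 2 ^ K * 24 else 0) := by
  have hN : (0 : ℝ) < (4 * 2 ^ K : ℕ) := by positivity
  -- This replaces conditioning on the past: the state and the value at time `t` do not depend on
  -- coordinate `t`, so averaging over that coordinate averages over the probe alone.
  have hresample := card_mul_sum_eq_sum_sum_update (W := Fin (4 * 2 ^ K)) (⟨t, ht⟩ : Fin T)
    fun ω => (trackingAlgorithm T K M).roundLoss B ω t + (state T K M B (t + 1) ω).potential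
  rw [Fintype.card_fin] at hresample
  refine le_of_mul_le_mul_left ?_ hN
  rw [hresample, Finset.mul_sum]
  refine Finset.sum_le_sum fun ω _ => ?_
  have hinv := invariant_state (K := K) (M := M) hε h1 hB ω ht
  set S := state T K M B t ω with hS
  set v := (trackingAlgorithm T K M).buyerValue B ω t with hv
  have hw (w : Fin (4 * 2 ^ K)) :
      (trackingAlgorithm T K M).roundLoss B (Function.update ω ⟨t, ht⟩ w) t +
        (state T K M B (t + 1) (Function.update ω ⟨t, ht⟩ w)).potential ≤
      S.cost v (probeOf K S.level w) + if (t + 1) % M = 0 then 2 ^ K * 24 else 0 := by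
    have e1 : state T K M B t (Function.update ω ⟨t, ht⟩ w) = S := state_update ω ⟨t, ht⟩ w
    have e2 : (trackingAlgorithm T K M).buyerValue B (Function.update ω ⟨t, ht⟩ w) t = v :=
      buyerValue_update ω ⟨t, ht⟩ w
    have e3 : extendSeed (Function.update ω ⟨t, ht⟩ w) t = w := extendSeed_update_self ω ⟨t, ht⟩ w
    have := roundLoss_add_potential_le (B := B) (M := M) (ω := Function.update ω ⟨t, ht⟩ w) (t := t)
      (by rw [e1]; exact hinv.valid) (by rw [e1]; exact fun a b => (hinv.valid.respond a b).potential_nonneg)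
    rwa [e1, e2, e3] at this
  refine (Finset.sum_le_sum fun w _ => hw w).trans ?_
  rw [Finset.sum_add_distrib, sum_probeOf hinv.level_le, Finset.sum_const, Finset.card_univ,
    Fintype.card_fin, nsmul_eq_mul, ← mul_add]
  refine mul_le_mul_of_nonneg_left (add_le_add_left ?_ _) hN.le
  refine (Tracker.expected_cost_le hinv.valid (unitInterval.le_one v)
    (hinv.level_ne_zero (h1 _)) (by ring)).trans ?_
  linarith [hinv.half_pow_level_le]

/-- The potential telescopes; the last term collects the initial potential and one fresh potential
per restart. -/
theorem integral_cumulativeLoss_le (hε : Antitone ε) (h1 : ∀ t, ε t ≤ 1)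
    (hB : B.HasChangingRate fun t : Fin T => ε t) (hM : 0 < M) :
    ∫ ω, (trackingAlgorithm T K M).cumulativeLoss B T ω ∂(trackingAlgorithm T K M).law ≤
      34 * ∑ t ∈ Finset.range T, √(ε t) + 34 * M + 17 * T * (1 / 2) ^ K +
        24 * 2 ^ K * ((T / M : ℕ) + 1) := by
  have hsum := sum_add_le_of_forall_sum_add_le (Ω := Fin T → Fin (4 * 2 ^ K))
    (fun t ω => (trackingAlgorithm T K M).roundLoss B ω t)
    (fun t ω => (state T K M B t ω).potential)
    (fun t => 17 * (2 * √(ε (M * (t / M))) + (1 / 2) ^ K) +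
      if (t + 1) % M = 0 then 2 ^ K * 24 else 0) T
    (fun t ht => by
      simpa only [add_assoc] using sum_roundLoss_add_potential_le (K := K) hε h1 hB ht)
  have hstart (ω : Fin T → Fin (4 * 2 ^ K)) : (state T K M B 0 ω).potential = 2 ^ K * 24 :=
    Tracker.potential_fresh K
  have hend (ω : Fin T → Fin (4 * 2 ^ K)) : 0 ≤ (state T K M B T ω).potential := by
    cases T with
    | zero => rw [hstart]; positivity
    | succ T =>
      have hinv := invariant_state (K := K) (M := M) hε h1 hB ω (Nat.lt_succ_self T)
      rw [state_succ]
      split_ifs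
      · exact (Tracker.valid_fresh K).potential_nonneg
      · exact (hinv.valid.respond _ _).potential_nonneg
  have hcard : (0 : ℝ) < Fintype.card (Fin T → Fin (4 * 2 ^ K)) := by
    exact_mod_cast Fintype.card_pos
  refine (integral_law _).trans_le ((div_le_iff₀' hcard).2 ?_)
  refine (Finset.sum_le_sum fun ω _ => le_add_of_nonneg_right (hend ω)).trans (hsum.trans ?_)
  simp only [hstart, Finset.sum_const, Finset.card_univ, nsmul_eq_mul, ← mul_add]
  refine mul_le_mul_of_nonneg_left ?_ hcard.le
  simp only [Finset.sum_add_distrib, ← Finset.mul_sum, sum_range_ite_succ_mod, Finset.sum_const,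
    Finset.card_range, nsmul_eq_mul]
  have hdelay := sum_sqrt_epoch_start_le hε h1 hM T
  linarith

end trackingAlgorithm

/-! ### Upper bound: average rates and choice of parameters -/

theorem sum_sqrt_le_mul_sqrt_averageRate {T : ℕ} {ε : Fin T → ℝ} (h0 : ∀ t, 0 ≤ ε t) :
    ∑ t, √(ε t) ≤ T * √(averageRate ε) := by
  rcases Nat.eq_zero_or_pos T with rfl | hT
  · simp
  have hT' : (0 : ℝ) < T := by exact_mod_cast hT
  have h := sq_sum_le_card_mul_sum_sq (s := Finset.univ) (f := fun t => √(ε t))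
  simp only [Real.sq_sqrt (h0 _), Finset.card_univ, Fintype.card_fin] at h
  refine (Real.le_sqrt_of_sq_le h).trans (le_of_eq ?_)
  rw [averageRate, ← Real.sqrt_sq hT'.le, ← Real.sqrt_mul (sq_nonneg _), Real.sqrt_sq hT'.le]
  congr 1
  field_simp

theorem averageRate_const {T : ℕ} (hT : 1 ≤ T) (e : ℝ) : averageRate (fun _ : Fin T => e) = e := by
  have hT' : (T : ℝ) ≠ 0 := by positivity
  simp [averageRate, hT']

/-- A sequence of changing rates, continued by zeros. -/
def extendRate {T : ℕ} (ε : Fin T → ℝ) (t : ℕ) : ℝ := if h : t < T then ε ⟨t, h⟩ else 0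

theorem extendRate_coe {T : ℕ} (ε : Fin T → ℝ) (t : Fin T) : extendRate ε t = ε t := by
  simp [extendRate]

theorem extendRate_mem {T : ℕ} {ε : Fin T → ℝ} (h : ∀ t, 0 ≤ ε t ∧ ε t ≤ 1) (t : ℕ) :
    0 ≤ extendRate ε t ∧ extendRate ε t ≤ 1 := by
  unfold extendRate
  split_ifs
  · exact h _
  · exact ⟨le_rfl, zero_le_one⟩

theorem antitone_extendRate {T : ℕ} {ε : Fin T → ℝ} (hε : Antitone ε) (h : ∀ t, 0 ≤ ε t) :
    Antitone (extendRate ε) := by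
  intro s t hst
  unfold extendRate
  split_ifs with h1 h2 h2
  · exact hε (Fin.mk_le_mk.2 hst)
  · omega
  · exact h _
  · exact le_rfl

/-- The level from which the tracking algorithm starts when there are `T` rounds. -/
def startLevel (T : ℕ) : ℕ := Nat.log 2 T / 4

theorem tendsto_startLevel : Tendsto startLevel atTop atTop := by
  refine tendsto_atTop.2 fun b => ?_
  filter_upwards [eventually_ge_atTop (2 ^ (4 * b))] with T hT
  have := Nat.le_log_of_pow_le one_lt_two hT
  unfold startLevel
  omega

theorem pow_startLevel_le {T : ℕ} (hT : 1 ≤ T) : 16 ^ startLevel T ≤ T := by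
  have h1 : (16 : ℕ) ^ startLevel T = 2 ^ (4 * startLevel T) := by
    rw [pow_mul]
    norm_num
  rw [h1]
  refine (Nat.pow_le_pow_right two_pos ?_).trans (Nat.pow_log_le_self 2 (by omega))
  unfold startLevel
  omega

/-- With epochs of `4 ^ K` rounds the restarts cost about `T * 2^(-K)`, like the level floor. As `16
^ K ≤ T`, the remaining terms in `4 ^ K` and `2 ^ K` are at most `8 ^ K ≤ T * 2^(-K)`. The constant
is `99 = 34 + 17 + 24 + 24`. -/
theorem expectedRevenueLoss_trackingAlgorithm_le {T : ℕ} (hT : 1 ≤ T) {ε : Fin T → ℝ}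
    (hε : Antitone ε) (h01 : ∀ t, 0 ≤ ε t ∧ ε t ≤ 1) {B : Adversary} (hB : B.HasChangingRate ε) :
    (trackingAlgorithm T (startLevel T) (4 ^ startLevel T)).expectedRevenueLoss B T ≤
      34 * √(averageRate ε) + 99 * (1 / 2) ^ startLevel T := by
  have hT' : (0 : ℝ) < T := by exact_mod_cast hT
  have h16 : (16 : ℝ) ^ startLevel T ≤ T := by exact_mod_cast pow_startLevel_le hT
  set K := startLevel T
  have hB' : B.HasChangingRate fun t : Fin T => extendRate ε t := by
    simpa only [extendRate_coe] using hB
  have hloss := trackingAlgorithm.integral_cumulativeLoss_le (K := K) (M := 4 ^ K)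
    (antitone_extendRate hε fun t => (h01 t).1)
    (fun t => (extendRate_mem h01 t).2) hB' (by positivity)
  rw [← Fin.sum_univ_eq_sum_range (fun t => √(extendRate ε t))] at hloss
  simp only [extendRate_coe] at hloss
  have hsum := sum_sqrt_le_mul_sqrt_averageRate fun t => (h01 t).1
  rw [PricingAlgorithm.expectedRevenueLoss_eq_integral_cumulativeLoss_div, div_le_iff₀ hT']
  have hdiv : ((T / 4 ^ K : ℕ) : ℝ) ≤ T / 4 ^ K := by
    exact_mod_cast Nat.cast_div_le (α := ℝ) (m := T) (n := 4 ^ K)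
  have ha : (2 : ℝ) ^ K * (T / 4 ^ K) = T * (1 / 2) ^ K := by
    rw [show (4 : ℝ) = 2 * 2 by norm_num, mul_pow, one_div, inv_pow]
    field_simp
  have hb := mul_le_mul_of_nonneg_left hdiv (by positivity : (0 : ℝ) ≤ 2 ^ K)
  have hc : (8 : ℝ) ^ K ≤ T * (1 / 2) ^ K := by
    have := mul_le_mul_of_nonneg_right h16 (by positivity : (0 : ℝ) ≤ (1 / 2) ^ K)
    rw [← mul_pow] at this
    norm_num at this ⊢
    exact this
  have hd : (4 : ℝ) ^ K ≤ 8 ^ K := pow_le_pow_left₀ (by norm_num) (by norm_num) K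
  have he : (2 : ℝ) ^ K ≤ 8 ^ K := pow_le_pow_left₀ (by norm_num) (by norm_num) K
  push_cast at hloss
  rw [ha] at hb
  linarith

theorem mainTheorem2 :
    (∃ (C : ℝ) (k : ℕ) (g : ℕ → ℝ) (A : ℕ → PricingAlgorithm),
      0 < C ∧ Tendsto g atTop (𝓝 0) ∧
      ∀ (T : ℕ), 1 ≤ T →
      ∀ (ε : Fin T → ℝ), Antitone ε → (∀ t, 0 ≤ ε t ∧ ε t ≤ 1) →
      ∀ (B : Adversary), B.HasChangingRate ε →
        (A T).expectedRevenueLoss B T ≤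
          C * √(averageRate ε) * (1 + Real.log (1 / averageRate ε)) ^ k + g T) ∧
    (∃ c : ℝ, 0 < c ∧
      ∀ (T : ℕ), 1 ≤ T →
      ∀ (e : ℝ), 0 ≤ e → e ≤ 1 →
      ∀ (A : PricingAlgorithm),
        ∃ v : ℕ → unitInterval,
          (Adversary.oblivious v).HasChangingRate (fun _ : Fin T => e) ∧
          c * √(averageRate (fun _ : Fin T => e)) ≤
            A.expectedRevenueLoss (Adversary.oblivious v) T) := by
  -- The exponent `0` removes the logarithm; at average rate `0` the square root vanishes, as the
  -- convention demands.
  refine ⟨⟨34, 0, fun T => 99 * (1 / 2) ^ startLevel T,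
    fun T => trackingAlgorithm T (startLevel T) (4 ^ startLevel T), by norm_num, ?_, ?_⟩,
    1 / 128, by norm_num, ?_⟩
  · have h := (tendsto_pow_atTop_nhds_zero_of_lt_one (r := (1 / 2 : ℝ)) (by norm_num)
      (by norm_num)).comp tendsto_startLevel
    simpa using h.const_mul 99
  · intro T hT ε hε h01 B hB
    rw [pow_zero, mul_one]
    exact expectedRevenueLoss_trackingAlgorithm_le hT hε h01 hB
  · intro T hT e he he' A
    obtain ⟨v, hv, hloss⟩ := exists_oblivious_sqrt_le A hT he he'
    refine ⟨v, fun t _ _ => hv t, ?_⟩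
    rw [averageRate_const hT]
    linarith

end
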